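/- Let $n\ge 1$ be an integer and $[n]=\{1,\dots,n\}$. Let $\emptyset\neq L\subseteq[n]$, $\ell=|L|$, $d\in\{1,\dots,\ell\}$, and let $M_1,\dots,M_d\subseteq L$ be pairwise disjoint non-empty sets with $\bigcup_{k=1}^d M_k=L$; put $m_k=|M_k|$. Let $Z=(z_{j,r})\in\mathbb{C}^{[n]\times L}$ and $$\alpha_{j,k}=\frac1{m_k}\sum_{r\in M_k}|z_{j,r}|^2\qquad(j\in[n],\ k\in\{1,\dots,d\}).$$ For $J\subseteq[n]$ with $|J|=\ell$, let $Z[J,L]$ denote the submatrix of $Z$ with rows in $J$, and let $$\operatorname{per}(Z[J,L])=\sum_{r}\prod_{j\in J}z_{j,r(j)}$$ be its permanent, where the sum is over all injective maps $r:J\to L$. Then $$\sum_{\substack{J\subseteq[n]\\|J|=\ell}}\bigl|\operatorname{per}(Z[J,L])\bigr|^2\le(\ell!)^2\binom{n}{\ell}\prod_{k=1}^d\Biggl(\frac1{\binom{n}{m_k}}\sum_{\substack{I\subseteq[n]\\|I|=m_k}}\ \prod_{j\in I}\alpha_{j,k}\Biggr).$$ -/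

import Mathlib

/-- The permanent of a complex matrix `A` with row index set `J` and column index set `R`
(meant for `|J| = |R|`): the sum, over all injective maps `r : J → R`, of the diagonal products
`∏ j, A j (r j)`. For `J = R = ∅` its value is `1`. -/
noncomputable def rectPer {J R : Type*} [Fintype J] [DecidableEq J] [Fintype R] [DecidableEq R]
    (A : Matrix J R ℂ) : ℂ :=
  ∑ r : J ↪ R, ∏ j, A j (r j)

/-! Encode each column of `Z` as a linear form in variables indexed by the rows. The coefficient of
the squarefree monomial on `J` in the product of these forms is the permanent of the rows `J`. With
the normalization in `sqfreeEnergy`, the squarefree energy is submultiplicative on products of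
homogeneous polynomials. This is applied twice: to group the columns into the blocks `M k`, and,
within a block, to the transposed product, where rows become linear forms in the column variables
(`sq_norm_sum_equiv_prod_le`).

Submultiplicativity reduces to `sum_sq_layerConv_le`, an L² bound for convolution on layers of the
cube that is sharp for constants. It is proved by symmetrization: replacing `f` and `g` by quadratic
means under a transposition keeps their L² norms and does not lower the energy, while it raises the
sum of values unless both are already invariant. By compactness, a maximizer of the energy with
largest sum of values is therefore constant on its layer. -/

open Finset

/-! ### Convolution on layers of the cube and symmetrization by transpositions. -/

section LayerConvolution

variable {α : Type*}

/-- The quadratic mean of `f` and its translate by the permutation `σ`. -/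
noncomputable def quadMean (σ : Equiv.Perm α) (f : Finset α → ℝ) (A : Finset α) : ℝ :=
  √((f A ^ 2 + f (A.map σ.toEmbedding) ^ 2) / 2)

theorem quadMean_nonneg (σ : Equiv.Perm α) (f : Finset α → ℝ) (A : Finset α) :
    0 ≤ quadMean σ f A := Real.sqrt_nonneg _

theorem sq_quadMean (σ : Equiv.Perm α) (f : Finset α → ℝ) (A : Finset α) :
    quadMean σ f A ^ 2 = (f A ^ 2 + f (A.map σ.toEmbedding) ^ 2) / 2 :=
  Real.sq_sqrt (by positivity)

theorem mean_le_quadMean (σ : Equiv.Perm α) (f : Finset α → ℝ) (A : Finset α) :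
    (f A + f (A.map σ.toEmbedding)) / 2 ≤ quadMean σ f A := by
  refine Real.le_sqrt_of_sq_le ?_
  nlinarith [sq_nonneg (f A - f (A.map σ.toEmbedding))]

theorem sum_powersetCard_map [Fintype α] (σ : Equiv.Perm α) (m : ℕ) (F : Finset α → ℝ) :
    ∑ J ∈ (univ : Finset α).powersetCard m, F (J.map σ.toEmbedding)
      = ∑ J ∈ (univ : Finset α).powersetCard m, F J := by
  conv_rhs => rw [← Finset.map_univ_equiv σ, Finset.powersetCard_map, Finset.sum_map]
  rfl

theorem sum_le_sum_quadMean [Fintype α] (σ : Equiv.Perm α) (a : ℕ) (f : Finset α → ℝ) :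
    ∑ A ∈ (univ : Finset α).powersetCard a, f A
      ≤ ∑ A ∈ (univ : Finset α).powersetCard a, quadMean σ f A := by
  refine le_trans (le_of_eq ?_) (Finset.sum_le_sum fun A _ => mean_le_quadMean σ f A)
  rw [← Finset.sum_div, Finset.sum_add_distrib, sum_powersetCard_map σ a f]
  ring

/-- Equality case of arithmetic mean ≤ quadratic mean, read off termwise. -/
theorem map_eq_of_sum_quadMean_le [Fintype α] (σ : Equiv.Perm α) (a : ℕ) (f : Finset α → ℝ)
    (h : ∑ A ∈ (univ : Finset α).powersetCard a, quadMean σ f A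
      ≤ ∑ A ∈ (univ : Finset α).powersetCard a, f A) (A : Finset α) (hA : A.card = a) :
    f (A.map σ.toEmbedding) = f A := by
  have heq : ∑ A ∈ (univ : Finset α).powersetCard a, (f A + f (A.map σ.toEmbedding)) / 2
      = ∑ A ∈ (univ : Finset α).powersetCard a, quadMean σ f A := by
    refine le_antisymm (Finset.sum_le_sum fun A _ => mean_le_quadMean σ f A) (h.trans ?_)
    rw [← Finset.sum_div, Finset.sum_add_distrib, sum_powersetCard_map σ a f]
    exact le_of_eq (by ring)
  have hpt := (Finset.sum_eq_sum_iff_of_le fun A _ => mean_le_quadMean σ f A).1 heq A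
    (Finset.mem_powersetCard.2 ⟨Finset.subset_univ _, hA⟩)
  have hsq := sq_quadMean σ f A
  rw [← hpt] at hsq
  have : (f A - f (A.map σ.toEmbedding)) ^ 2 = 0 := by nlinarith
  have := pow_eq_zero_iff (two_ne_zero) |>.1 this
  linarith

variable [DecidableEq α]

/-- The convolution over splittings of `J` into a part of size `a` and its complement. -/
def layerConv (a : ℕ) (f g : Finset α → ℝ) (J : Finset α) : ℝ :=
  ∑ A ∈ J.powersetCard a, f A * g (J \ A)

theorem map_swap_eq_self {i j : α} {A : Finset α} (hi : i ∉ A) (hj : j ∉ A) :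
    A.map (Equiv.swap i j).toEmbedding = A := by
  ext x
  rw [Finset.mem_map_equiv, Equiv.symm_swap]
  rcases eq_or_ne x i with rfl | hxi
  · simp [hi, hj]
  rcases eq_or_ne x j with rfl | hxj
  · simp [hi, hj]
  rw [Equiv.swap_apply_of_ne_of_ne hxi hxj]

theorem map_swap_eq_self_of_mem {i j : α} {A : Finset α} (hi : i ∈ A) (hj : j ∈ A) :
    A.map (Equiv.swap i j).toEmbedding = A := by
  ext x
  rw [Finset.mem_map_equiv, Equiv.symm_swap]
  rcases eq_or_ne x i with rfl | hxi
  · simp [hi, hj]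
  rcases eq_or_ne x j with rfl | hxj
  · simp [hi, hj]
  rw [Equiv.swap_apply_of_ne_of_ne hxi hxj]

theorem map_sdiff_equiv (σ : Equiv.Perm α) (J A : Finset α) :
    J.map σ.toEmbedding \ A.map σ.toEmbedding = (J \ A).map σ.toEmbedding := by
  ext x
  simp [Finset.mem_map_equiv, Finset.mem_sdiff]

theorem layerConv_map (σ : Equiv.Perm α) (a : ℕ) (f g : Finset α → ℝ) (J : Finset α) :
    layerConv a f g (J.map σ.toEmbedding)
      = ∑ A ∈ J.powersetCard a, f (A.map σ.toEmbedding) * g ((J \ A).map σ.toEmbedding) := by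
  unfold layerConv
  rw [Finset.powersetCard_map, Finset.sum_map]
  refine Finset.sum_congr rfl fun A _ => ?_
  simp [Finset.mapEmbedding_apply, map_sdiff_equiv]

theorem layerConv_nonneg (a : ℕ) {f g : Finset α → ℝ} (hf : ∀ A, 0 ≤ f A) (hg : ∀ A, 0 ≤ g A)
    (J : Finset α) : 0 ≤ layerConv a f g J :=
  Finset.sum_nonneg fun _ _ => mul_nonneg (hf _) (hg _)

/-- Minkowski's inequality in the Euclidean plane for a finite sum. -/
theorem sq_sum_add_sq_sum_le {ι : Type*} (s : Finset ι) (x y : ι → ℝ) :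
    (∑ i ∈ s, x i) ^ 2 + (∑ i ∈ s, y i) ^ 2 ≤ (∑ i ∈ s, √(x i ^ 2 + y i ^ 2)) ^ 2 := by
  have h := norm_sum_le s fun i => (⟨x i, y i⟩ : ℂ)
  have hn : ∀ z : ℂ, ‖z‖ = √(z.re ^ 2 + z.im ^ 2) := fun z => by
    rw [Complex.norm_def, Complex.normSq_apply]; ring_nf
  simp only [hn, Complex.re_sum, Complex.im_sum] at h
  exact (Real.sqrt_le_left (Finset.sum_nonneg fun _ _ => Real.sqrt_nonneg _)).1 h

/-- If the transposition fixes `J`, Cauchy–Schwarz applies to the terms of `A` and its image.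
Otherwise `J` contains exactly one of `i`, `j`, so one of `A`, `J \ A` is fixed, and Minkowski's
inequality suffices. -/
theorem layerConv_sq_add_sq_le (i j : α) (a : ℕ) {f g : Finset α → ℝ}
    (hf : ∀ A, 0 ≤ f A) (hg : ∀ A, 0 ≤ g A) (J : Finset α) :
    layerConv a f g J ^ 2 + layerConv a f g (J.map (Equiv.swap i j).toEmbedding) ^ 2
      ≤ 2 * layerConv a (quadMean (Equiv.swap i j) f) (quadMean (Equiv.swap i j) g) J ^ 2 := by
  set σ := Equiv.swap i j
  by_cases hJ : J.map σ.toEmbedding = J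
  · have key : layerConv a f g J ≤ layerConv a (quadMean σ f) (quadMean σ g) J := by
      have h2 : 2 * layerConv a f g J ≤ 2 * layerConv a (quadMean σ f) (quadMean σ g) J := by
        have h3 : 2 * layerConv a f g J
            = layerConv a f g J + layerConv a f g (J.map σ.toEmbedding) := by rw [hJ]; ring
        rw [h3, layerConv_map]
        unfold layerConv
        rw [← Finset.sum_add_distrib, Finset.mul_sum]
        refine Finset.sum_le_sum fun A _ => ?_
        refine abs_le_of_sq_le_sq' ?_ (mul_nonneg zero_le_two (mul_nonneg (quadMean_nonneg _ _ _)
          (quadMean_nonneg _ _ _))) |>.2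
        rw [mul_pow, mul_pow, sq_quadMean, sq_quadMean]
        nlinarith [sq_nonneg (f A * g ((J \ A).map σ.toEmbedding)
          - f (A.map σ.toEmbedding) * g (J \ A))]
      linarith
    rw [hJ]
    nlinarith [pow_le_pow_left₀ (layerConv_nonneg a hf hg J) key 2]
  · rw [layerConv_map]
    unfold layerConv
    refine (sq_sum_add_sq_sum_le _ _ _).trans (le_of_eq ?_)
    have h2 : (2 : ℝ) = √2 ^ 2 := (Real.sq_sqrt zero_le_two).symm
    rw [h2, ← mul_pow, Finset.mul_sum]
    congr 1
    refine Finset.sum_congr rfl fun A hA => ?_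
    have hAJ := (Finset.mem_powersetCard.1 hA).1
    have hfix : A.map σ.toEmbedding = A ∨ (J \ A).map σ.toEmbedding = J \ A := by
      by_cases hi : i ∈ J
      · have hj : j ∉ J := fun hj => hJ (map_swap_eq_self_of_mem hi hj)
        by_cases hiA : i ∈ A
        · exact Or.inr (map_swap_eq_self (by simp [hiA]) (by simp [hj]))
        · exact Or.inl (map_swap_eq_self hiA fun h => hj (hAJ h))
      · by_cases hjA : j ∈ A
        · exact Or.inr (map_swap_eq_self (by simp [hi]) (by simp [hjA]))
        · exact Or.inl (map_swap_eq_self (fun h => hi (hAJ h)) hjA)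
    have hnn : 0 ≤ √2 * (quadMean σ f A * quadMean σ g (J \ A)) := by
      have := quadMean_nonneg σ f A
      have := quadMean_nonneg σ g (J \ A)
      positivity
    rw [← Real.sqrt_sq hnn]
    congr 1
    rw [mul_pow √2, ← h2, mul_pow (quadMean σ f A), sq_quadMean, sq_quadMean]
    rcases hfix with h | h <;> rw [h] <;> ring

/-! ### Maximizing the energy over a product of spheres. -/

variable [Fintype α]

/-- The sum of squares of the convolution on the layer of sets of size `a + b`. -/
def layerEnergy (a b : ℕ) (f g : Finset α → ℝ) : ℝ :=
  ∑ J ∈ (univ : Finset α).powersetCard (a + b), layerConv a f g J ^ 2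

theorem layerEnergy_le_quadMean (i j : α) (a b : ℕ) {f g : Finset α → ℝ}
    (hf : ∀ A, 0 ≤ f A) (hg : ∀ A, 0 ≤ g A) :
    layerEnergy a b f g
      ≤ layerEnergy a b (quadMean (Equiv.swap i j) f) (quadMean (Equiv.swap i j) g) := by
  have h : 2 * layerEnergy a b f g = ∑ J ∈ (univ : Finset α).powersetCard (a + b),
      (layerConv a f g J ^ 2 + layerConv a f g (J.map (Equiv.swap i j).toEmbedding) ^ 2) := by
    rw [Finset.sum_add_distrib, sum_powersetCard_map (Equiv.swap i j) (a + b)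
      fun J => layerConv a f g J ^ 2, layerEnergy]
    ring
  have h' := Finset.sum_le_sum fun J (_ : J ∈ (univ : Finset α).powersetCard (a + b)) =>
    layerConv_sq_add_sq_le i j a hf hg J
  rw [← h, ← Finset.mul_sum] at h'
  unfold layerEnergy at *
  linarith

/-- Nonnegative functions supported on the sets of size `a` with sum of squares `s`. -/
def layerSphere (α : Type*) [Fintype α] [DecidableEq α] (a : ℕ) (s : ℝ) : Set (Finset α → ℝ) :=
  {f | (∀ A, 0 ≤ f A) ∧ (∀ A, A.card ≠ a → f A = 0) ∧
    ∑ A ∈ (univ : Finset α).powersetCard a, f A ^ 2 = s}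

theorem isCompact_layerSphere (a : ℕ) (s : ℝ) : IsCompact (layerSphere α a s) := by
  refine Metric.isCompact_of_isClosed_isBounded ?_ ?_
  · unfold layerSphere
    simp only [Set.ofPred_and, Set.ofPred_forall]
    refine IsClosed.inter (isClosed_iInter fun A => isClosed_le (by fun_prop) (by fun_prop))
      (IsClosed.inter (isClosed_iInter fun A => isClosed_iInter fun _ =>
        isClosed_eq (by fun_prop) (by fun_prop)) (isClosed_eq (by fun_prop) (by fun_prop)))
  · refine (Metric.isBounded_closedBall (x := (0 : Finset α → ℝ)) (r := √s)).subset ?_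
    rintro f ⟨hf, h0, hs⟩
    rw [mem_closedBall_zero_iff, pi_norm_le_iff_of_nonneg (Real.sqrt_nonneg _)]
    intro A
    rw [Real.norm_of_nonneg (hf A)]
    by_cases hA : A.card = a
    · refine Real.le_sqrt_of_sq_le ?_
      rw [← hs]
      exact Finset.single_le_sum (f := fun A => f A ^ 2) (fun _ _ => sq_nonneg _)
        (Finset.mem_powersetCard.2 ⟨Finset.subset_univ _, hA⟩)
    · rw [h0 A hA]; exact Real.sqrt_nonneg _

theorem quadMean_mem_layerSphere (σ : Equiv.Perm α) {a : ℕ} {s : ℝ} {f : Finset α → ℝ}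
    (hf : f ∈ layerSphere α a s) : quadMean σ f ∈ layerSphere α a s := by
  obtain ⟨h1, h2, h3⟩ := hf
  refine ⟨quadMean_nonneg σ f, fun A hA => ?_, ?_⟩
  · simp [quadMean, h2 A hA, h2 (A.map σ.toEmbedding) (by simpa using hA)]
  · simp only [sq_quadMean]
    rw [← Finset.sum_div, Finset.sum_add_distrib,
      sum_powersetCard_map σ a fun A => f A ^ 2, h3]
    ring

/-- Transpositions generate the symmetric group, which acts transitively on each layer. -/
theorem eq_of_swap_invariant {a : ℕ} {f : Finset α → ℝ}
    (h : ∀ i j : α, ∀ A : Finset α, A.card = a →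
      f (A.map (Equiv.swap i j).toEmbedding) = f A)
    {A B : Finset α} (hA : A.card = a) (hB : B.card = a) : f A = f B := by
  have hperm : ∀ σ : Equiv.Perm α, ∀ A : Finset α, A.card = a →
      f (A.map σ.toEmbedding) = f A := by
    intro σ
    induction σ using Equiv.Perm.swap_induction_on with
    | one => intro A _; congr 1; exact Finset.map_refl
    | swap_mul τ i j _ ih =>
      intro A hA
      rw [← ih A hA, ← h i j (A.map τ.toEmbedding) (by simpa using hA), Finset.map_map]
      rfl
  have e : {x // x ∈ A} ≃ {x // x ∈ B} := Finset.equivOfCardEq (hA.trans hB.symm)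
  rw [← hperm e.extendSubtype A hA]
  congr 1
  refine Finset.eq_of_subset_of_card_le (fun x hx => ?_) (by simp [hA, hB])
  obtain ⟨y, hy, rfl⟩ := Finset.mem_map.1 hx
  exact e.extendSubtype_mem y hy

theorem layerEnergy_const (a b : ℕ) (f g : Finset α → ℝ) {c e : ℝ}
    (hf : ∀ A, A.card = a → f A = c) (hg : ∀ A, A.card = b → g A = e) :
    layerEnergy a b f g
      = (Fintype.card α).choose (a + b) * (((a + b).choose a : ℝ) * (c * e)) ^ 2 := by
  have h : ∀ J ∈ (univ : Finset α).powersetCard (a + b),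
      layerConv a f g J ^ 2 = (((a + b).choose a : ℝ) * (c * e)) ^ 2 := by
    intro J hJ
    have hJc := (Finset.mem_powersetCard.1 hJ).2
    unfold layerConv
    rw [Finset.sum_congr rfl (g := fun _ => c * e), Finset.sum_const, Finset.card_powersetCard,
      hJc, nsmul_eq_mul]
    intro A hA
    obtain ⟨h1, h2⟩ := Finset.mem_powersetCard.1 hA
    rw [hf A h2, hg]
    rw [Finset.card_sdiff_of_subset h1]; omega
  rw [layerEnergy, Finset.sum_congr rfl h, Finset.sum_const, Finset.card_powersetCard,
    Finset.card_univ, nsmul_eq_mul]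

theorem layerEnergy_le_of_mem {a b : ℕ} (hab : a + b ≤ Fintype.card α) {s t : ℝ}
    {f g : Finset α → ℝ} (hf : f ∈ layerSphere α a s) (hg : g ∈ layerSphere α b t) :
    layerEnergy a b f g ≤ (Fintype.card α).choose (a + b) * ((a + b).choose a : ℝ) ^ 2 *
      (s / (Fintype.card α).choose a * (t / (Fintype.card α).choose b)) := by
  have hK := (isCompact_layerSphere (α := α) a s).prod (isCompact_layerSphere (α := α) b t)
  have hΦ : Continuous fun x : (Finset α → ℝ) × (Finset α → ℝ) => layerEnergy a b x.1 x.2 := by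
    unfold layerEnergy layerConv
    fun_prop
  obtain ⟨x, hx, hxmax⟩ := hK.exists_isMaxOn ⟨(f, g), hf, hg⟩ hΦ.continuousOn
  -- The maximizers form a compact set; the sum of values serves as tie-breaker among them.
  have hK' := hK.inter_right (isClosed_eq hΦ (continuous_const (y := layerEnergy a b x.1 x.2)))
  have hV : Continuous fun x : (Finset α → ℝ) × (Finset α → ℝ) =>
      (∑ A ∈ (univ : Finset α).powersetCard a, x.1 A)
        + ∑ A ∈ (univ : Finset α).powersetCard b, x.2 A := by fun_prop
  obtain ⟨y, ⟨⟨hy1, hy2⟩, hyx⟩, hymax⟩ := hK'.exists_isMaxOn ⟨x, hx, rfl⟩ hV.continuousOn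
  have hyx' : layerEnergy a b y.1 y.2 = layerEnergy a b x.1 x.2 := hyx
  have hswap : ∀ i j : α,
      (∀ A : Finset α, A.card = a → y.1 (A.map (Equiv.swap i j).toEmbedding) = y.1 A) ∧
      (∀ A : Finset α, A.card = b → y.2 (A.map (Equiv.swap i j).toEmbedding) = y.2 A) := by
    intro i j
    have hmem : (quadMean (Equiv.swap i j) y.1, quadMean (Equiv.swap i j) y.2) ∈
        layerSphere α a s ×ˢ layerSphere α b t :=
      ⟨quadMean_mem_layerSphere _ hy1, quadMean_mem_layerSphere _ hy2⟩
    have hle := layerEnergy_le_quadMean i j a b hy1.1 hy2.1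
    have hge := hxmax hmem
    -- The symmetrized pair is again a maximizer, so neither sum of values can have grown.
    have hv := hymax ⟨hmem, le_antisymm hge (hyx' ▸ hle)⟩
    simp only [Set.mem_ofPred_eq] at hv
    have h1 := sum_le_sum_quadMean (Equiv.swap i j) a y.1
    have h2 := sum_le_sum_quadMean (Equiv.swap i j) b y.2
    exact ⟨map_eq_of_sum_quadMean_le _ _ _ (by linarith),
      map_eq_of_sum_quadMean_le _ _ _ (by linarith)⟩
  have hconst : ∀ (m : ℕ) (u : ℝ) (F : Finset α → ℝ), m ≤ Fintype.card α →
      F ∈ layerSphere α m u →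
      (∀ i j : α, ∀ A : Finset α, A.card = m →
        F (A.map (Equiv.swap i j).toEmbedding) = F A) →
      ∃ c : ℝ, (∀ A, A.card = m → F A = c) ∧ c ^ 2 = u / (Fintype.card α).choose m := by
    intro m u F hm hF hinv
    obtain ⟨B, -, hB⟩ := Finset.exists_subset_card_eq (s := (univ : Finset α)) (n := m)
      (by simpa using hm)
    have hc : ∀ A, A.card = m → F A = F B := fun A hA => eq_of_swap_invariant hinv hA hB
    refine ⟨F B, hc, ?_⟩
    have h0 : ((Fintype.card α).choose m : ℝ) ≠ 0 := by
      exact_mod_cast (Nat.choose_pos hm).ne'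
    rw [eq_div_iff h0, ← hF.2.2, Finset.sum_congr rfl (g := fun _ => F B ^ 2), Finset.sum_const,
      Finset.card_powersetCard, Finset.card_univ, nsmul_eq_mul, mul_comm]
    intro A hA
    rw [hc A (Finset.mem_powersetCard.1 hA).2]
  obtain ⟨c, hc, hc2⟩ := hconst a s y.1 (by omega) hy1 fun i j => (hswap i j).1
  obtain ⟨e, he, he2⟩ := hconst b t y.2 (by omega) hy2 fun i j => (hswap i j).2
  refine (hxmax (a := (f, g)) ⟨hf, hg⟩).trans (le_of_eq ?_)
  show layerEnergy a b x.1 x.2 = _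
  rw [← hyx', layerEnergy_const a b y.1 y.2 hc he, ← hc2, ← he2]
  ring

/-- The normalized convolution of functions on layers of the cube is a contraction in `L²`. -/
theorem sum_sq_layerConv_le (a b : ℕ) (f g : Finset α → ℝ) (hf : ∀ A, 0 ≤ f A)
    (hg : ∀ A, 0 ≤ g A) :
    ∑ J ∈ (univ : Finset α).powersetCard (a + b),
        (∑ A ∈ J.powersetCard a, f A * g (J \ A)) ^ 2
      ≤ (Fintype.card α).choose (a + b) * ((a + b).choose a : ℝ) ^ 2 *
        ((∑ A ∈ (univ : Finset α).powersetCard a, f A ^ 2) / (Fintype.card α).choose a *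
        ((∑ A ∈ (univ : Finset α).powersetCard b, g A ^ 2) / (Fintype.card α).choose b)) := by
  by_cases hab : a + b ≤ Fintype.card α
  -- Values off the layer never enter the convolution; setting them to zero gives membership in the
  -- compact sphere.
  · have htrunc : ∀ (m : ℕ) (F : Finset α → ℝ), (∀ A, 0 ≤ F A) →
        (fun A => if A.card = m then F A else 0) ∈
          layerSphere α m (∑ A ∈ (univ : Finset α).powersetCard m, F A ^ 2) := by
      intro m F hF
      refine ⟨fun A => ?_, fun A hA => if_neg hA, Finset.sum_congr rfl fun A hA => ?_⟩
      · dsimp only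
        split_ifs
        exacts [hF A, le_rfl]
      · simp [(Finset.mem_powersetCard.1 hA).2]
    refine le_trans (le_of_eq ?_) (layerEnergy_le_of_mem hab (htrunc a f hf) (htrunc b g hg))
    refine Finset.sum_congr rfl fun J hJ => congrArg (· ^ 2) (Finset.sum_congr rfl fun A hA => ?_)
    obtain ⟨h1, h2⟩ := Finset.mem_powersetCard.1 hA
    have h3 := (Finset.mem_powersetCard.1 hJ).2
    have h4 : (J \ A).card = b := by rw [Finset.card_sdiff_of_subset h1]; omega
    simp [h2, h4]
  · rw [Finset.powersetCard_eq_empty.2 (by simpa using hab), Finset.sum_empty]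
    positivity

end LayerConvolution

/-! ### Squarefree coefficients of products of linear forms. -/

section PermanentPolynomials

open MvPolynomial

variable {α : Type*}

/-- The exponent vector of the squarefree monomial supported on `J`. -/
noncomputable def sqfreeExp (J : Finset α) : α →₀ ℕ := ∑ j ∈ J, Finsupp.single j 1

theorem sqfreeExp_apply [DecidableEq α] (J : Finset α) (x : α) :
    sqfreeExp J x = if x ∈ J then 1 else 0 := by
  simp [sqfreeExp, Finsupp.finsetSum_apply, Finsupp.single_apply]

theorem degree_sqfreeExp (J : Finset α) : (sqfreeExp J).degree = J.card := by
  simp [sqfreeExp]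

/-- The normalized sum of squares of the squarefree coefficients of `p` of degree `m`. -/
noncomputable def sqfreeEnergy [Fintype α] (m : ℕ) (p : MvPolynomial α ℂ) : ℝ :=
  (∑ J ∈ (univ : Finset α).powersetCard m, ‖coeff (sqfreeExp J) p‖ ^ 2)
    / (Fintype.card α).choose m / (m.factorial : ℝ) ^ 2

theorem sqfreeEnergy_nonneg [Fintype α] (m : ℕ) (p : MvPolynomial α ℂ) : 0 ≤ sqfreeEnergy m p := by
  unfold sqfreeEnergy; positivity

/-- The linear form with coefficient vector `v`. -/
noncomputable def linForm [Fintype α] (v : α → ℂ) : MvPolynomial α ℂ := ∑ x, C (v x) * X x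

theorem isHomogeneous_linForm [Fintype α] (v : α → ℂ) : (linForm v).IsHomogeneous 1 :=
  IsHomogeneous.sum _ _ _ fun x _ => by
    simpa using (isHomogeneous_C α (v x)).mul (isHomogeneous_X ℂ x)

theorem isHomogeneous_prod_linForm [Fintype α] {κ : Type*} (K : Finset κ) (v : κ → α → ℂ) :
    (∏ k ∈ K, linForm (v k)).IsHomogeneous K.card := by
  simpa using IsHomogeneous.prod K (fun k => linForm (v k)) (fun _ => 1)
    fun k _ => isHomogeneous_linForm (v k)

variable [DecidableEq α]

theorem sqfreeExp_injective : Function.Injective (sqfreeExp : Finset α → α →₀ ℕ) := by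
  intro A B h
  ext x
  have := DFunLike.congr_fun h x
  rw [sqfreeExp_apply, sqfreeExp_apply] at this
  split_ifs at this <;> simp_all

theorem sum_antidiagonal_sqfreeExp {N : Type*} [AddCommMonoid N] (J : Finset α)
    (F : (α →₀ ℕ) × (α →₀ ℕ) → N) :
    ∑ x ∈ antidiagonal (sqfreeExp J), F x
      = ∑ A ∈ J.powerset, F (sqfreeExp A, sqfreeExp (J \ A)) := by
  symm
  refine Finset.sum_bij (fun A _ => (sqfreeExp A, sqfreeExp (J \ A))) ?_ ?_ ?_ fun _ _ => rfl
  · intro A hA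
    rw [HasAntidiagonal.mem_antidiagonal]
    ext x
    have : x ∈ A → x ∈ J := fun h => Finset.mem_powerset.1 hA h
    simp only [Finsupp.add_apply, sqfreeExp_apply, Finset.mem_sdiff]
    by_cases h : x ∈ A <;> simp_all
  · intro A _ B _ h
    exact sqfreeExp_injective (Prod.ext_iff.1 h).1
  · rintro ⟨u, v⟩ huv
    rw [HasAntidiagonal.mem_antidiagonal] at huv
    have hx : ∀ x, u x + v x = if x ∈ J then 1 else 0 := fun x => by
      rw [← sqfreeExp_apply, ← huv]; rfl
    refine ⟨J.filter fun x => u x = 1, Finset.mem_powerset.2 (Finset.filter_subset _ _), ?_⟩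
    refine Prod.ext (Finsupp.ext fun x => ?_) (Finsupp.ext fun x => ?_)
    all_goals
      have := hx x
      simp only [sqfreeExp_apply, Finset.mem_filter, Finset.mem_sdiff]
      by_cases hJ : x ∈ J <;> by_cases h1 : u x = 1 <;> simp [hJ, h1] at this ⊢ <;> omega

/-- Both parts of a splitting of a squarefree exponent are squarefree, and homogeneity fixes the
size of the first part: squarefree coefficients multiply by layer convolution. -/
theorem coeff_sqfreeExp_mul {a : ℕ} {p : MvPolynomial α ℂ} (hp : p.IsHomogeneous a)
    (q : MvPolynomial α ℂ) (J : Finset α) :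
    coeff (sqfreeExp J) (p * q)
      = ∑ A ∈ J.powersetCard a, coeff (sqfreeExp A) p * coeff (sqfreeExp (J \ A)) q := by
  rw [coeff_mul, sum_antidiagonal_sqfreeExp]
  symm
  refine Finset.sum_subset (fun A hA => ?_) fun A hA hA' => ?_
  · exact Finset.mem_powerset.2 (Finset.mem_powersetCard.1 hA).1
  · rw [hp.coeff_eq_zero, zero_mul]
    rw [degree_sqfreeExp]
    exact fun h => hA' (Finset.mem_powersetCard.2 ⟨Finset.mem_powerset.1 hA, h⟩)

variable [Fintype α]

theorem sqfreeEnergy_mul_le {a : ℕ} (b : ℕ) {p : MvPolynomial α ℂ} (hp : p.IsHomogeneous a)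
    (q : MvPolynomial α ℂ) :
    sqfreeEnergy (a + b) (p * q) ≤ sqfreeEnergy a p * sqfreeEnergy b q := by
  have h := sum_sq_layerConv_le a b (fun A => ‖coeff (sqfreeExp A) p‖)
    (fun A => ‖coeff (sqfreeExp A) q‖) (fun _ => norm_nonneg _) (fun _ => norm_nonneg _)
  have hle : ∑ J ∈ (univ : Finset α).powersetCard (a + b), ‖coeff (sqfreeExp J) (p * q)‖ ^ 2
      ≤ _ := le_trans (Finset.sum_le_sum fun J _ => by
        rw [coeff_sqfreeExp_mul hp]
        refine pow_le_pow_left₀ (norm_nonneg _) ((norm_sum_le _ _).trans (le_of_eq ?_)) 2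
        exact Finset.sum_congr rfl fun A _ => norm_mul _ _) h
  by_cases hab : a + b ≤ Fintype.card α
  · have hc : (((Fintype.card α).choose (a + b) : ℕ) : ℝ) ≠ 0 := by
      exact_mod_cast (Nat.choose_pos hab).ne'
    -- The squared factorials in `sqfreeEnergy` absorb the factor `((a + b).choose a) ^ 2` of the
    -- convolution bound.
    have hfac : (((a + b).choose a : ℕ) : ℝ) * a.factorial * b.factorial
        = (a + b).factorial := by
      rw [Nat.choose_symm_add]
      exact_mod_cast Nat.add_choose_mul_factorial_mul_factorial a b
    have ha : (a.factorial : ℝ) ≠ 0 := by positivity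
    have hb : (b.factorial : ℝ) ≠ 0 := by positivity
    have hm : (((a + b).choose a : ℕ) : ℝ) ≠ 0 := by
      exact_mod_cast (Nat.choose_pos (by omega)).ne'
    unfold sqfreeEnergy
    rw [div_div, div_le_iff₀ (by positivity), ← hfac]
    refine hle.trans (le_of_eq ?_)
    generalize ((Fintype.card α).choose (a + b) : ℝ) = c1
    generalize ((Fintype.card α).choose a : ℝ) = c2
    generalize ((Fintype.card α).choose b : ℝ) = c3
    field_simp
  · have : sqfreeEnergy (a + b) (p * q) = 0 := by
      unfold sqfreeEnergy
      rw [Finset.powersetCard_eq_empty.2 (by simpa using hab)]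
      simp
    rw [this]
    exact mul_nonneg (sqfreeEnergy_nonneg _ _) (sqfreeEnergy_nonneg _ _)

theorem sqfreeEnergy_prod_le {κ : Type*} (K : Finset κ) (m : κ → ℕ) (p : κ → MvPolynomial α ℂ)
    (hp : ∀ k, (p k).IsHomogeneous (m k)) :
    sqfreeEnergy (∑ k ∈ K, m k) (∏ k ∈ K, p k) ≤ ∏ k ∈ K, sqfreeEnergy (m k) (p k) := by
  classical
  induction K using Finset.induction_on with
  | empty => simp [sqfreeEnergy, sqfreeExp]
  | insert k K hk ih =>
    rw [Finset.sum_insert hk, Finset.prod_insert hk, Finset.prod_insert hk]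
    exact (sqfreeEnergy_mul_le _ (hp k) _).trans
      (mul_le_mul_of_nonneg_left ih (sqfreeEnergy_nonneg _ _))

theorem sqfreeEnergy_linForm (v : α → ℂ) :
    sqfreeEnergy 1 (linForm v) = (∑ x, ‖v x‖ ^ 2) / Fintype.card α := by
  unfold sqfreeEnergy
  rw [Finset.powersetCard_one, Finset.sum_map]
  simp [linForm, sqfreeExp, coeff_C_mul, coeff_X, coeff_sum, Finsupp.single_left_inj]

theorem coeff_prod_linForm {κ : Type*} [Fintype κ] [DecidableEq κ] (v : κ → α → ℂ) (u : α →₀ ℕ) :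
    coeff u (∏ k, linForm (v k))
      = ∑ c : κ → α, if ∑ k, Finsupp.single (c k) 1 = u then ∏ k, v k (c k) else 0 := by
  unfold linForm
  rw [Finset.prod_univ_sum, Fintype.piFinset_univ, coeff_sum]
  refine Finset.sum_congr rfl fun c _ => ?_
  have : ∏ k, (C (v k (c k)) * X (c k) : MvPolynomial α ℂ)
      = monomial (∑ k, Finsupp.single (c k) 1) (∏ k, v k (c k)) := by
    rw [monomial_sum_index]
    rw [Finset.prod_mul_distrib, map_prod]
    rfl
  rw [this, coeff_monomial]

/-- The squarefree coefficient of a product of linear forms is a sum over bijections. -/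
theorem coeff_sqfreeExp_prod_linForm {κ : Type*} [Fintype κ] [DecidableEq κ] (v : κ → α → ℂ)
    (J : Finset α) :
    coeff (sqfreeExp J) (∏ k, linForm (v k)) = ∑ σ : κ ≃ J, ∏ k, v k (σ k) := by
  rw [coeff_prod_linForm, ← Finset.sum_filter]
  symm
  refine Finset.sum_bij (fun σ _ k => (σ k : α)) ?_ ?_ ?_ fun _ _ => rfl
  · intro σ _
    refine Finset.mem_filter.2 ⟨Finset.mem_univ _, ?_⟩
    rw [sqfreeExp, ← Finset.sum_coe_sort J]
    exact Equiv.sum_comp σ fun j : J => Finsupp.single (j : α) 1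
  · intro σ _ τ _ h
    ext k
    exact congrFun h k
  · intro c hc
    have hc := (Finset.mem_filter.1 hc).2
    have hx : ∀ x, (univ.filter fun k => c k = x).card = if x ∈ J then 1 else 0 := fun x => by
      rw [← sqfreeExp_apply, ← hc]
      simp [Finsupp.finsetSum_apply, Finsupp.single_apply]
    have hmem : ∀ k, c k ∈ J := fun k => by
      by_contra h
      have := hx (c k)
      rw [if_neg h, Finset.card_eq_zero, Finset.filter_eq_empty_iff] at this
      exact this (Finset.mem_univ k) rfl
    have hbij : Function.Bijective fun k => (⟨c k, hmem k⟩ : J) := by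
      constructor
      · intro k l hkl
        have hkl : c k = c l := congrArg Subtype.val hkl
        have := hx (c l)
        rw [if_pos (hmem l)] at this
        exact Finset.card_le_one.1 this.le k (by simp [hkl]) l (by simp)
      · rintro ⟨x, hxJ⟩
        have := hx x
        rw [if_pos hxJ] at this
        obtain ⟨k, hk⟩ := Finset.card_pos.1 (this ▸ Nat.one_pos)
        exact ⟨k, Subtype.ext (Finset.mem_filter.1 hk).2⟩
    exact ⟨Equiv.ofBijective _ hbij, Finset.mem_univ _, rfl⟩

end PermanentPolynomials

/-! ### The bound for a single block and the final assembly. -/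

section HadamardPermanent

open MvPolynomial

/-- The Hadamard type inequality of Carlen, Lieb and Loss for permanents. -/
theorem sq_norm_sum_equiv_prod_le {α κ : Type*} [DecidableEq α] [Fintype κ]
    [DecidableEq κ] (v : κ → α → ℂ) (I : Finset α) (hI : I.card = Fintype.card κ) :
    ‖∑ σ : κ ≃ I, ∏ k, v k (σ k)‖ ^ 2
      ≤ ((Fintype.card κ).factorial : ℝ) ^ 2
        * ∏ j ∈ I, ((∑ k, ‖v k j‖ ^ 2) / Fintype.card κ) := by
  -- Transposed roles: the elements of `I` index the linear forms and `κ` the variables. The total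
  -- degree equals the number of variables, so only the full monomial survives.
  have h := sqfreeEnergy_prod_le (univ : Finset I) (fun _ => 1)
    (fun j => linForm fun k => v k j) fun j => isHomogeneous_linForm _
  have hcard : ∑ _j : I, 1 = Fintype.card κ := by simp [hI]
  have hcoeff : coeff (sqfreeExp univ) (∏ j : I, linForm fun k => v k j)
      = ∑ σ : κ ≃ I, ∏ k, v k (σ k) := by
    rw [coeff_sqfreeExp_prod_linForm (fun (j : I) k => v k j)]
    refine Fintype.sum_equiv
      ((Equiv.equivCongr (Equiv.refl _) (Equiv.subtypeUnivEquiv Finset.mem_univ)).trans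
        ⟨Equiv.symm, Equiv.symm, fun _ => rfl, fun _ => rfl⟩) _ _ fun σ => ?_
    refine Fintype.prod_equiv (σ.trans (Equiv.subtypeUnivEquiv Finset.mem_univ)) _ _ fun j => ?_
    simp
  rw [hcard] at h
  simp only [sqfreeEnergy_linForm] at h
  rw [Finset.prod_coe_sort I fun j => (∑ k, ‖v k j‖ ^ 2) / (Fintype.card κ : ℝ)] at h
  unfold sqfreeEnergy at h
  rw [← Finset.card_univ, Finset.powersetCard_self, Finset.sum_singleton, hcoeff,
    Finset.card_univ, Nat.choose_self, Nat.cast_one, div_one, div_le_iff₀ (by positivity)] at h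
  rwa [mul_comm]

theorem rectPer_eq_sum_equiv {J R : Type*} [Fintype J] [DecidableEq J] [Fintype R]
    [DecidableEq R] (A : Matrix J R ℂ) (h : Fintype.card J = Fintype.card R) :
    rectPer A = ∑ σ : R ≃ J, ∏ r, A (σ r) r := by
  unfold rectPer
  symm
  refine Fintype.sum_bijective (fun σ : R ≃ J => σ.symm.toEmbedding) ⟨?_, ?_⟩ _ _ fun σ => ?_
  · intro σ τ hst
    apply Equiv.symm_bijective.1
    ext x
    exact DFunLike.congr_fun hst x
  · intro e
    have hb : Function.Bijective e := (Fintype.bijective_iff_injective_and_card e).2 ⟨e.2, h⟩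
    exact ⟨(Equiv.ofBijective e hb).symm, by ext x; rfl⟩
  · exact Fintype.prod_equiv σ _ _ fun r => by simp

theorem sqfreeEnergy_prod_linForm_le {α ρ : Type*} [Fintype α] [DecidableEq α] [DecidableEq ρ]
    (A : Matrix α ρ ℂ) (K : Finset ρ) :
    sqfreeEnergy K.card (∏ r ∈ K, linForm fun j => A j r)
      ≤ 1 / ((Fintype.card α).choose K.card : ℝ) *
        ∑ I ∈ (univ : Finset α).powersetCard K.card,
          ∏ j ∈ I, (1 / (K.card : ℝ) * ∑ r ∈ K, ‖A j r‖ ^ 2) := by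
  unfold sqfreeEnergy
  rw [div_right_comm, div_eq_mul_one_div, mul_comm]
  refine mul_le_mul_of_nonneg_left ?_ (by positivity)
  rw [div_le_iff₀ (by positivity), Finset.sum_mul]
  refine Finset.sum_le_sum fun I hI => ?_
  have h := sq_norm_sum_equiv_prod_le (fun (r : K) j => A j r) I
    (by simpa using (Finset.mem_powersetCard.1 hI).2)
  rw [← Finset.prod_coe_sort K, coeff_sqfreeExp_prod_linForm (fun (r : K) j => A j r)]
  refine h.trans (le_of_eq ?_)
  rw [mul_comm, Fintype.card_coe]
  congr 1
  refine Finset.prod_congr rfl fun j _ => ?_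
  rw [Finset.sum_coe_sort K fun r => ‖A j r‖ ^ 2]
  ring

end HadamardPermanent

theorem mainTheorem2 (n : ℕ) (hn : 1 ≤ n) (L : Finset (Fin n)) (hL : L.Nonempty)
    (d : ℕ) (hd : 1 ≤ d) (hdL : d ≤ L.card)
    (M : Fin d → Finset L)
    (hMne : ∀ k, (M k).Nonempty)
    (hMdisj : ∀ k k' : Fin d, k ≠ k' → Disjoint (M k) (M k'))
    (hMunion : Finset.univ.biUnion M = Finset.univ)
    (Z : Matrix (Fin n) L ℂ) :
    ∑ J ∈ (Finset.univ : Finset (Fin n)).powersetCard L.card,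
        ‖rectPer (Z.submatrix (fun j : J => (j : Fin n)) (fun r : L => r))‖ ^ 2
      ≤ ((L.card.factorial : ℝ)) ^ 2 * (n.choose L.card : ℝ) *
        ∏ k : Fin d, (1 / (n.choose (M k).card : ℝ) *
          ∑ I ∈ (Finset.univ : Finset (Fin n)).powersetCard (M k).card,
            ∏ j ∈ I, (1 / ((M k).card : ℝ) * ∑ r ∈ M k, ‖Z j r‖ ^ 2)) := by
  have hdisj : ((univ : Finset (Fin d)) : Set (Fin d)).PairwiseDisjoint M :=
    fun k _ k' _ hkk' => hMdisj k k' hkk'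
  have hcard : ∑ k, (M k).card = L.card := by
    rw [← Finset.card_biUnion hdisj, hMunion, Finset.card_univ, Fintype.card_coe]
  have hprod : ∏ k, ∏ r ∈ M k, linForm (fun j => Z j r) = ∏ r : L, linForm fun j => Z j r := by
    rw [← Finset.prod_biUnion hdisj, hMunion]
  have h := (sqfreeEnergy_prod_le (univ : Finset (Fin d)) (fun k => (M k).card)
    (fun k => ∏ r ∈ M k, linForm fun j => Z j r) fun k =>
      isHomogeneous_prod_linForm (M k) fun r j => Z j r).trans
    (Finset.prod_le_prod (fun k _ => sqfreeEnergy_nonneg _ _)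
      fun k _ => sqfreeEnergy_prod_linForm_le Z (M k))
  rw [hcard, hprod, Fintype.card_fin] at h
  have hc : (0 : ℝ) < n.choose L.card := by
    exact_mod_cast Nat.choose_pos (by simpa using Finset.card_le_univ L)
  unfold sqfreeEnergy at h
  rw [Fintype.card_fin, div_div, div_le_iff₀ (by positivity)] at h
  -- Clearing the normalization of the energy on the left has produced the factor `(ℓ!)² * n.choose
  -- ℓ`.
  refine le_trans (le_of_eq (Finset.sum_congr rfl fun J hJ => ?_)) (h.trans (le_of_eq (by ring)))
  rw [rectPer_eq_sum_equiv _ (by simpa using (Finset.mem_powersetCard.1 hJ).2),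
    coeff_sqfreeExp_prod_linForm fun (r : L) j => Z j r]
  rfl
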